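/- Let $\alpha_0,\alpha_1$ be the simple roots of the affine Lie algebra $\hat{\mathfrak{sl}}_2$, let $Q=\mathbb Z\alpha_0\oplus\mathbb Z\alpha_1$, let $\delta=\alpha_0+\alpha_1$, and let $\overline W\subset \mathrm{GL}(Q)$ be the affine Weyl group, generated by the simple reflections $s_0,s_1$; let $W=\{1,s_1\}$ be the finite Weyl group. The roots are the real roots $\pm\alpha_1+n\delta$ ($n\in\mathbb Z$) and the imaginary roots $n\delta$ ($n\in\mathbb Z\setminus\{0\}$, each with multiplicity one), and $\Delta^+$ is the set of the positive roots, real and imaginary (those with nonnegative coefficients with respect to $\alpha_0,\alpha_1$). For $n\ge 0$ let $w_n=\cdots s_0s_1s_0$ ($n$ factors, alternating, ending in $s_0$); the fixed points of $\Omega SU(2)$ are indexed by the cosets $w_mW$, $m\ge0$, and its Schubert varieties are $X_n=X_{w_n}$. For a reduced word $w=s_{i_1}\cdots s_{i_n}$ let $f(w)=\prod_{j=1}^n e^{s_{i_1}\cdots s_{i_{j-1}}(\alpha_{i_j})}$. Let $K$ be the fraction field of the group algebra $\mathbb Z[Q]$ (with basis $e^\beta$, $\beta\in Q$), with the action $v\cdot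 e^\beta=e^{v\beta}$ of $\overline W$ and the involution $\overline{e^\beta}=e^{-\beta}$. In the twisted group ring $\bigoplus_{v\in\overline W}K\delta_v$, with product $(q\,\delta_v)(q'\,\delta_{v'})=q\,(v\cdot q')\,\delta_{vv'}$, put $$T_{s_i}=\frac1{1-e^{\alpha_i}}\,\delta_{s_i}+\frac1{1-e^{-\alpha_i}}\,\delta_{1},\qquad T_w=T_{s_{i_1}}\cdots T_{s_{i_n}}=\sum_v b_{w,v}\,\delta_v$$ for a reduced word $w=s_{i_1}\cdots s_{i_n}$. The rational function of $X_n$ at the fixed point $w_mW$ in the localization formula is $$R_m(X_n)=\sum_{v\in\overline W,\ vW=w_mW}\overline{b_{w_n,v}}\in K .$$ The function $R_m(\Omega SU(2))$ is the limit of $R_m(X_n)$ for $n\to\infty$, where the $R_m(X_n)$ are expanded as formal power series in $e^{\alpha_0},e^{\alpha_1}$ with integral coefficients and the limit is taken coefficientwise. Then for every integer $m\ge0$ these expansions and this limit exist, and $$R_m(\Omega SU(2))=\frac{(-1)^m\,f(w_m)\,\bigl(1-e^{w_m\cdot\alpha_1}\bigr)}{\prod_{\alpha\in\Delta^+}(1-e^{\alpha})},$$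 where the infinite product converges coefficientwise to a nonzero formal power series. -/

import Mathlib

open Filter Topology
open scoped MvPowerSeries.WithPiTopology

noncomputable section

namespace AffineSL2

/-! ### Root lattice, simple roots and affine Weyl group -/

/-- The root lattice `ℤ α₀ ⊕ ℤ α₁` of affine `sl₂`; the coordinates are those with respect to the
simple roots. -/
abbrev RootLattice : Type := Fin 2 → ℤ

/-- The simple roots `α₀`, `α₁`. -/
def simpleRoot (i : Fin 2) : RootLattice := Pi.single i 1

/-- The smallest positive imaginary root `δ = α₀ + α₁`. -/
def delta : RootLattice := simpleRoot 0 + simpleRoot 1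

/-- The generalized Cartan matrix of affine `sl₂`: the entry `i j` is the value of the simple
coroot `αᵢ^∨` on the simple root `αⱼ`. -/
def cartan : Matrix (Fin 2) (Fin 2) ℤ := !![2, -2; -2, 2]

/-- The pairing with the simple coroot `αᵢ^∨`. -/
def corootPairing (i : Fin 2) : RootLattice →ₗ[ℤ] ℤ :=
  ∑ j, cartan i j • LinearMap.proj j

theorem corootPairing_simpleRoot (i : Fin 2) : corootPairing i (simpleRoot i) = 2 := by
  fin_cases i <;> simp [corootPairing, simpleRoot, cartan]

/-- The simple reflection `β ↦ β - ⟨β, αᵢ^∨⟩ αᵢ`. -/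
def reflection (i : Fin 2) : RootLattice ≃ₗ[ℤ] RootLattice :=
  Module.reflection (corootPairing_simpleRoot i)

theorem reflection_apply (i : Fin 2) (β : RootLattice) :
    reflection i β = β - corootPairing i β • simpleRoot i := by
  simp [reflection, Module.reflection_apply]

/-- The affine Weyl group, as the group of automorphisms of the root lattice (on which it acts
faithfully) generated by the simple reflections `s₀`, `s₁`. -/
def weylGroup : Subgroup (RootLattice ≃ₗ[ℤ] RootLattice) :=
  Subgroup.closure (Set.range reflection)

/-- The simple reflection `sᵢ` as an element of the affine Weyl group. -/
def s (i : Fin 2) : weylGroup := ⟨reflection i, Subgroup.subset_closure ⟨i, rfl⟩⟩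

/-- The finite Weyl group `W = {1, s₁}`, as a subgroup of the affine Weyl group. -/
def finiteWeylGroup : Subgroup weylGroup := Subgroup.closure {s 1}

/-- The reduced word of `wₙ`, the element of length `n` of the chain
`s₀ ≤ s₁ s₀ ≤ s₀ s₁ s₀ ≤ ⋯` of minimal length representatives of the cosets modulo the finite
Weyl group (and `w₀` is the identity). -/
def word : ℕ → List (Fin 2)
  | 0 => []
  | n + 1 => (if Even n then 0 else 1) :: word n

/-- The element of the affine Weyl group represented by a word. -/
def wordProd (l : List (Fin 2)) : weylGroup := (l.map s).prod

/-- The element `wₙ` of the affine Weyl group. -/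
def w (n : ℕ) : weylGroup := wordProd (word n)

/-- For a reduced word `s_{i₁} ⋯ s_{iₙ}`, the sum of roots
`∑ⱼ s_{i₁} ⋯ s_{i_{j-1}} (α_{iⱼ})`. -/
def inversionSum (l : List (Fin 2)) : RootLattice :=
  ∑ j : Fin l.length, (wordProd (l.take j)).1 (simpleRoot (l.get j))

/-! ### Roots -/

/-- The real roots `± α₁ + n δ`, `n ∈ ℤ`. -/
def realRoots : Set RootLattice :=
  {β | ∃ n : ℤ, β = simpleRoot 1 + n • delta ∨ β = -simpleRoot 1 + n • delta}

/-- The imaginary roots `n δ`, `n ≠ 0` (each of multiplicity one). -/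
def imaginaryRoots : Set RootLattice := {β | ∃ n : ℤ, n ≠ 0 ∧ β = n • delta}

/-- The positive roots, real and imaginary: those roots whose coefficients with respect to the
simple roots are nonnegative. -/
def positiveRoots : Set RootLattice := {β | β ∈ realRoots ∪ imaginaryRoots ∧ 0 ≤ β}

/-! ### The group algebra of the character lattice and its fraction field -/

/-- The group algebra of the lattice, with basis the exponentials `e^β`. -/
abbrev CharRing : Type := AddMonoidAlgebra ℤ RootLattice

/-- The field of rational functions: the fraction field of the group algebra. -/
abbrev CharField : Type := FractionRing CharRing

/-- The exponential `e^β` in the field of rational functions. -/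
def e (β : RootLattice) : CharField := algebraMap CharRing CharField (AddMonoidAlgebra.single β 1)

/-- The automorphism of the group algebra that is induced by an automorphism of the lattice. -/
def charRingAut : (RootLattice ≃ₗ[ℤ] RootLattice) →* (CharRing ≃+* CharRing) where
  toFun g := (AddMonoidAlgebra.domCongr ℤ ℤ g.toAddEquiv).toRingEquiv
  map_one' := by
    refine RingEquiv.ext fun x => ?_
    induction x using AddMonoidAlgebra.induction_linear with
    | zero => simp
    | add a b ha hb => rw [map_add, ha, hb, map_add]
    | single a b => simp
  map_mul' g h := by
    refine RingEquiv.ext fun x => ?_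
    induction x using AddMonoidAlgebra.induction_linear with
    | zero => simp
    | add a b ha hb => rw [map_add, ha, hb, map_add]
    | single a b => simp

/-- The automorphism of the field of rational functions that is induced by an automorphism `g` of
the lattice: it sends `e^β` to `e^(g β)`. -/
def charFieldAut : (RootLattice ≃ₗ[ℤ] RootLattice) →* (CharField ≃+* CharField) :=
  (IsFractionRing.ringEquivOfRingEquivHom CharRing CharField).comp charRingAut

theorem charFieldAut_e (g : RootLattice ≃ₗ[ℤ] RootLattice) (β : RootLattice) :
    charFieldAut g (e β) = e (g β) := by
  simp [charFieldAut, charRingAut, e]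

/-- The action of the affine Weyl group on rational functions, `w • e^β = e^(w β)`. -/
instance : MulSemiringAction weylGroup CharField :=
  MulSemiringAction.compHom CharField (charFieldAut.comp weylGroup.subtype)

theorem smul_e (v : weylGroup) (β : RootLattice) : v • e β = e (v.1 β) := charFieldAut_e v.1 β

/-- The involution `e^β ↦ e^(-β)` of the field of rational functions. -/
def bar : CharField ≃+* CharField := charFieldAut (LinearEquiv.neg ℤ)

theorem bar_e (β : RootLattice) : bar (e β) = e (-β) := charFieldAut_e _ β

/-! ### The twisted group ring and the functions `R_m(X_n)` -/

/-- The twisted group ring of the affine Weyl group over the field of rational functions: it has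
the basis `δ_v = single v 1` and the product `(q δ_v) (q' δ_{v'}) = q (v • q') δ_{v v'}`. -/
abbrev TwistedGroupRing : Type := SkewMonoidAlgebra CharField weylGroup

/-- `T_{sᵢ} = (1 - e^{αᵢ})⁻¹ δ_{sᵢ} + (1 - e^{-αᵢ})⁻¹ δ_1`. -/
def Tsimple (i : Fin 2) : TwistedGroupRing :=
  SkewMonoidAlgebra.single (s i) (1 - e (simpleRoot i))⁻¹ +
    SkewMonoidAlgebra.single 1 (1 - e (-simpleRoot i))⁻¹

/-- `T_w = T_{s_{i₁}} ⋯ T_{s_{iₙ}}` for a reduced word `s_{i₁} ⋯ s_{iₙ}` of `w`. -/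
def T (l : List (Fin 2)) : TwistedGroupRing := (l.map Tsimple).prod

/-- The coefficients `b_{w,v}` in `T_w = ∑_v b_{w,v} δ_v`. -/
def b (l : List (Fin 2)) (v : weylGroup) : CharField := (T l).coeff v

open Classical in
/-- The rational function `R_m(X_n)` that the Schubert variety `X_n` of `w_n` has at the fixed
point `w_m W`: the sum of the conjugates of the `b_{w_n, v}` over all `v` with `v W = w_m W`, where
`W` is the finite Weyl group. (Only finitely many coefficients `b_{w_n, v}` are nonzero.) -/
def Rschubert (m n : ℕ) : CharField :=
  ∑ v ∈ (T (word n)).support with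
      (QuotientGroup.mk v : weylGroup ⧸ finiteWeylGroup) = QuotientGroup.mk (w m),
    bar (b (word n) v)

/-! ### Formal expansion of rational functions -/

/-- Formal power series with integral coefficients in `X 0 = e^{α₀}` and `X 1 = e^{α₁}`, with the
topology of coefficientwise convergence. -/
abbrev FormalSeries : Type := MvPowerSeries (Fin 2) ℤ

/-- The quotient field of the domain of formal power series. -/
abbrev FormalField : Type := FractionRing FormalSeries

/-- The variable `e^{αᵢ}` in the quotient field of the ring of formal power series. -/
def x (i : Fin 2) : FormalField := algebraMap FormalSeries FormalField (MvPowerSeries.X i)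

theorem x_ne_zero (i : Fin 2) : x i ≠ 0 := by
  rw [x, Ne, FaithfulSMul.algebraMap_eq_zero_iff]
  intro h
  have := congrArg (MvPowerSeries.coeff (Finsupp.single i 1)) h
  simp at this

/-- The ring homomorphism from the group algebra with `e^{a α₀ + b α₁} ↦ (X 0)^a (X 1)^b`. -/
def expandCharRing : CharRing →+* FormalField :=
  (AddMonoidAlgebra.lift ℤ FormalField RootLattice
    { toFun := fun β => ∏ i, x i ^ (β.toAdd i)
      map_one' := by simp
      map_mul' := fun β γ => by
        simp [zpow_add₀ (x_ne_zero _), Finset.prod_mul_distrib] }).toRingHom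

theorem expandCharRing_single (β : RootLattice) (c : ℤ) :
    expandCharRing (AddMonoidAlgebra.single β c) = c * ∏ i, x i ^ (β i) := by
  simp [expandCharRing, AddMonoidAlgebra.lift_single, Algebra.smul_def]

/-- The monomial `e^β` as a formal power series, for `β ≥ 0`. -/
def formalExp (β : RootLattice) : FormalSeries := ∏ i, MvPowerSeries.X i ^ (β i).toNat

theorem formalExp_eq_monomial (β : RootLattice) :
    formalExp β =
      MvPowerSeries.monomial (Finsupp.equivFunOnFinite.symm fun i => (β i).toNat) 1 := by
  rw [formalExp, Fin.prod_univ_two, MvPowerSeries.X_pow_eq, MvPowerSeries.X_pow_eq,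
    MvPowerSeries.monomial_mul_monomial, mul_one]
  refine congrArg (fun d => MvPowerSeries.monomial d (1 : ℤ)) (Finsupp.ext fun i => ?_)
  fin_cases i <;> simp

theorem algebraMap_formalExp {β : RootLattice} (hβ : 0 ≤ β) :
    algebraMap FormalSeries FormalField (formalExp β) = ∏ i, x i ^ (β i) := by
  rw [formalExp, map_prod]
  refine Finset.prod_congr rfl fun i _ => ?_
  rw [map_pow, ← x, ← zpow_natCast, Int.toNat_of_nonneg (hβ i)]

theorem coeff_formalExp {β γ : RootLattice} (hβ : 0 ≤ β) (hγ : 0 ≤ γ) :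
    MvPowerSeries.coeff (Finsupp.equivFunOnFinite.symm fun i => (γ i).toNat) (formalExp β) =
      if β = γ then 1 else 0 := by
  classical
  rw [formalExp_eq_monomial, MvPowerSeries.coeff_monomial]
  congr 1
  rw [Equiv.apply_eq_iff_eq, funext_iff, funext_iff]
  refine propext (forall_congr' fun i => ?_)
  have h1 : 0 ≤ β i := hβ i
  have h2 : 0 ≤ γ i := hγ i
  constructor <;> intro h <;> omega

theorem expandCharRing_injective : Function.Injective expandCharRing := by
  rw [injective_iff_map_eq_zero]
  intro f hf
  by_contra hne
  obtain ⟨β₀, hβ₀⟩ := Finsupp.support_nonempty_iff.2 (fun h => hne (AddMonoidAlgebra.ext h))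
  obtain ⟨N, hN⟩ : ∃ N : RootLattice, ∀ β ∈ f.coeff.support, 0 ≤ β + N := by
    obtain ⟨M, hM⟩ := (f.coeff.support.finite_toSet).bddBelow
    refine ⟨-M, fun β hβ => ?_⟩
    have := hM hβ
    rw [← sub_eq_add_neg]
    exact sub_nonneg.2 this
  have key : algebraMap FormalSeries FormalField
      (∑ β ∈ f.coeff.support, MvPowerSeries.C (f.coeff β) * formalExp (β + N)) = 0 := by
    have h0 : expandCharRing (f * AddMonoidAlgebra.single N 1) = 0 := by rw [map_mul, hf, zero_mul]
    rw [← h0]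
    conv_rhs => rw [← AddMonoidAlgebra.sum_coeff_single f]
    rw [Finsupp.sum, Finset.sum_mul, map_sum, map_sum]
    refine Finset.sum_congr rfl fun β hβ => ?_
    rw [AddMonoidAlgebra.single_mul_single, mul_one, expandCharRing_single, map_mul,
      algebraMap_formalExp (hN β hβ)]
    simp
  rw [FaithfulSMul.algebraMap_eq_zero_iff] at key
  have := congrArg (MvPowerSeries.coeff
    (Finsupp.equivFunOnFinite.symm fun i => ((β₀ + N) i).toNat)) key
  rw [map_sum, Finset.sum_congr rfl (g := fun β => if β = β₀ then f.coeff β₀ else 0)] at this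
  · rw [Finset.sum_ite_eq' _ _, if_pos hβ₀] at this
    exact (Finsupp.mem_support_iff.1 hβ₀) (by simpa using this)
  · intro β hβ
    rw [MvPowerSeries.coeff_C_mul, coeff_formalExp (hN β hβ) (hN β₀ hβ₀)]
    by_cases h : β = β₀ <;> simp [h]

/-- The embedding of the field of rational functions in the quotient field of the ring of formal
power series, with `e^{αᵢ} ↦ X i`. A rational function `r` has the formal power series `F` as its
expansion if and only if `expand r` is the image of `F`. -/
def expand : CharField →+* FormalField := IsFractionRing.lift expandCharRing_injective

theorem expand_e (β : RootLattice) : expand (e β) = ∏ i, x i ^ (β i) := by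
  rw [expand, e, IsFractionRing.lift_algebraMap, expandCharRing_single]; simp

theorem expand_e_of_nonneg {β : RootLattice} (hβ : 0 ≤ β) :
    expand (e β) = algebraMap FormalSeries FormalField (formalExp β) := by
  rw [expand_e, algebraMap_formalExp hβ]

/-- `R` is the function `R_m(ΩSU(2))`: the limit, for `n → ∞`, of the rational functions
`R_m(X_n)` of the Schubert varieties that exhaust `ΩSU(2)`, each of them expanded as a formal power
series in `e^{α₀}`, `e^{α₁}`. -/
def IsLoopGroupR (m : ℕ) (R : FormalSeries) : Prop :=
  ∃ r : ℕ → FormalSeries,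
    (∀ n, algebraMap FormalSeries FormalField (r n) = expand (Rschubert m n)) ∧
      Tendsto r atTop (𝓝 R)

end AffineSL2

end

noncomputable section
namespace AffineSL2

/-! ### Reflections and the chain of minimal coset representatives -/

/-- The first letter of the reduced word of `wₘ` for `m ≥ 1`, extended by parity to `m = 0`. -/
def letter (m : ℕ) : Fin 2 := if Even m then 1 else 0

theorem word_succ (n : ℕ) : word (n + 1) = letter (n + 1) :: word n := by
  rw [word, letter]
  by_cases h : Even n <;> simp [h, Nat.even_add_one]

theorem w_succ (n : ℕ) : w (n + 1) = s (letter (n + 1)) * w n := by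
  rw [w, word_succ, wordProd, List.map_cons, List.prod_cons]; rfl

theorem letter_congr {m n : ℕ} (h : m % 2 = n % 2) : letter m = letter n := by
  simp [letter, Nat.even_iff, h]

theorem letter_succ_ne (m : ℕ) : letter (m + 1) ≠ letter m := by
  by_cases h : Even m <;> simp [letter, h, Nat.even_add_one]

theorem reflection_simpleRoot_self (i : Fin 2) :
    reflection i (simpleRoot i) = -simpleRoot i := by
  rw [reflection_apply, corootPairing_simpleRoot]; module

theorem simpleRoot_add_of_ne {i j : Fin 2} (h : i ≠ j) : simpleRoot i + simpleRoot j = delta := by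
  fin_cases i <;> fin_cases j <;> simp_all [delta, add_comm]

theorem corootPairing_simpleRoot_of_ne {i j : Fin 2} (h : i ≠ j) :
    corootPairing i (simpleRoot j) = -2 := by
  fin_cases i <;> fin_cases j <;> simp_all [corootPairing, simpleRoot, cartan]

theorem reflection_delta (i : Fin 2) : reflection i delta = delta := by
  obtain ⟨j, hj⟩ : ∃ j, i ≠ j := (exists_ne i).imp fun _ h => h.symm
  rw [reflection_apply, ← simpleRoot_add_of_ne hj, map_add, corootPairing_simpleRoot,
    corootPairing_simpleRoot_of_ne hj]
  simp

theorem reflection_simpleRoot_of_ne {i j : Fin 2} (h : i ≠ j) :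
    reflection i (simpleRoot j) = simpleRoot i + delta := by
  rw [reflection_apply, corootPairing_simpleRoot_of_ne h, ← simpleRoot_add_of_ne h]; module

theorem s_mul_self (i : Fin 2) : s i * s i = 1 :=
  Subtype.ext (LinearEquiv.ext fun β => by
    change reflection i (reflection i β) = β
    exact Module.involutive_reflection (corootPairing_simpleRoot i) β)

theorem w_simpleRoot_one (m : ℕ) :
    (w m).1 (simpleRoot 1) = simpleRoot (letter m) + m • delta := by
  induction m with
  | zero => simp [w, word, wordProd, letter]
  | succ m ih =>
    rw [w_succ]
    change reflection _ ((w m).1 _) = _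
    rw [ih, map_add, map_nsmul, reflection_delta, reflection_simpleRoot_of_ne (letter_succ_ne m)]
    module

theorem inversionSum_cons (i : Fin 2) (l : List (Fin 2)) :
    inversionSum (i :: l) = simpleRoot i + reflection i (inversionSum l) := by
  rw [inversionSum, inversionSum, map_sum]
  erw [Fin.sum_univ_succ]
  congr 1

theorem inversionSum_word (m : ℕ) :
    inversionSum (word m) = ∑ k ∈ Finset.range m, (simpleRoot (letter m) + k • delta) := by
  induction m with
  | zero => rfl
  | succ m ih =>
    rw [word_succ, inversionSum_cons, ih, Finset.sum_range_succ', map_sum, add_comm]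
    congr 1
    · refine Finset.sum_congr rfl fun k _ => ?_
      rw [map_add, map_nsmul, reflection_delta, reflection_simpleRoot_of_ne (letter_succ_ne m)]
      module
    · simp

theorem smul_simpleRoot_add_smul_delta_apply_self (i : Fin 2) (a k : ℤ) :
    (a • simpleRoot i + k • delta) i = a + k := by
  fin_cases i <;> simp [simpleRoot, delta]

theorem smul_simpleRoot_add_smul_delta_apply_of_ne {i j : Fin 2} (h : j ≠ i) (a k : ℤ) :
    (a • simpleRoot i + k • delta) j = k := by
  fin_cases i <;> fin_cases j <;> simp_all [simpleRoot, delta]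

theorem smul_simpleRoot_add_smul_delta_inj (i : Fin 2) {a b k l : ℤ}
    (h : a • simpleRoot i + k • delta = b • simpleRoot i + l • delta) : a = b ∧ k = l := by
  obtain ⟨j, hj⟩ : ∃ j, j ≠ i := exists_ne i
  have h1 := congrFun h i
  have h2 := congrFun h j
  rw [smul_simpleRoot_add_smul_delta_apply_self, smul_simpleRoot_add_smul_delta_apply_self] at h1
  rw [smul_simpleRoot_add_smul_delta_apply_of_ne hj, smul_simpleRoot_add_smul_delta_apply_of_ne hj] at h2
  omega

theorem finiteWeylGroup_apply {v : weylGroup} (hv : v ∈ finiteWeylGroup) :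
    ∃ a : ℤ, v.1 (simpleRoot 1) = a • simpleRoot 1 := by
  have key : ∀ v ∈ finiteWeylGroup, ∀ a : ℤ, ∃ a' : ℤ,
      v.1 (a • simpleRoot 1) = a' • simpleRoot 1 := by
    intro v hv
    induction hv using Subgroup.closure_induction with
    | mem u hu =>
      obtain rfl := Set.mem_singleton_iff.1 hu
      intro a
      refine ⟨-a, ?_⟩
      change reflection 1 _ = _
      rw [map_smul, reflection_simpleRoot_self]; module
    | one => exact fun a => ⟨a, rfl⟩
    | mul u v _ _ hu hv =>
      intro a
      obtain ⟨a', ha'⟩ := hv a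
      obtain ⟨b, hb⟩ := hu a'
      exact ⟨b, by rw [← hb, ← ha']; rfl⟩
    | inv u hu hu' =>
      intro a
      have hs : u = 1 ∨ u = s 1 := by
        have : u ∈ Subgroup.closure {s 1} := hu
        rw [Subgroup.mem_closure_singleton] at this
        obtain ⟨n, rfl⟩ := this
        have h2 : s 1 ^ (2 : ℤ) = 1 := by rw [zpow_two, s_mul_self]
        rcases Int.even_or_odd' n with ⟨k, rfl | rfl⟩
        · left; rw [zpow_mul, h2, one_zpow]
        · right; rw [zpow_add, zpow_mul, h2, one_zpow, one_mul, zpow_one]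
      rcases hs with rfl | rfl
      · exact hu' a
      · rw [inv_eq_of_mul_eq_one_left (s_mul_self 1)]
        exact hu' a
  simpa using key v hv 1

theorem mk_w_eq_mk_one_iff {m : ℕ} :
    (QuotientGroup.mk (w m) : weylGroup ⧸ finiteWeylGroup) = QuotientGroup.mk 1 ↔ m = 0 := by
  constructor
  · intro h
    rw [eq_comm, QuotientGroup.eq, inv_one, one_mul] at h
    obtain ⟨a, ha⟩ := finiteWeylGroup_apply h
    rw [w_simpleRoot_one] at ha
    have h1 := congrFun ha 0
    have h2 := congrFun ha 1
    by_cases hm : Even m <;> simp [letter, hm, simpleRoot, delta] at h1 h2 <;> omega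
  · rintro rfl; rfl

theorem mk_s_mul_w (m : ℕ) : (QuotientGroup.mk (s (letter m) * w m) :
    weylGroup ⧸ finiteWeylGroup) = QuotientGroup.mk (w (m - 1)) := by
  cases m with
  | zero =>
    have h : s 1 ∈ finiteWeylGroup := Subgroup.subset_closure rfl
    rw [eq_comm, QuotientGroup.eq]
    simpa [w, word, wordProd, letter] using h
  | succ m => rw [w_succ, ← mul_assoc, s_mul_self, one_mul, Nat.add_sub_cancel]

/-! ### The recursion for the functions of the Schubert varieties -/

theorem bar_smul (v : weylGroup) (a : CharField) : bar (v • a) = v • bar a := by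
  have h : LinearEquiv.neg ℤ * v.1 = v.1 * LinearEquiv.neg ℤ :=
    LinearEquiv.ext fun β => (map_neg v.1 β).symm
  have h' := congrArg charFieldAut h
  rw [map_mul, map_mul] at h'
  exact RingEquiv.congr_fun h' a

open Classical in
/-- The sum of the conjugates of the coefficients over a coset of the finite Weyl group. -/
def cosetSum (c : weylGroup ⧸ finiteWeylGroup) (f : TwistedGroupRing) : CharField :=
  f.sum fun v a => if (QuotientGroup.mk v : weylGroup ⧸ finiteWeylGroup) = c then bar a else 0

theorem Rschubert_eq_cosetSum (m n : ℕ) :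
    Rschubert m n = cosetSum (QuotientGroup.mk (w m)) (T (word n)) := by
  classical
  rw [Rschubert, cosetSum, SkewMonoidAlgebra.sum_def', Finset.sum_filter]
  rfl

theorem cosetSum_add (c : weylGroup ⧸ finiteWeylGroup) (f g : TwistedGroupRing) :
    cosetSum c (f + g) = cosetSum c f + cosetSum c g := by
  refine SkewMonoidAlgebra.sum_add_index' (fun v => by simp) fun v a a' => ?_
  split_ifs <;> simp

open Classical in
theorem cosetSum_single (c : weylGroup ⧸ finiteWeylGroup) (v : weylGroup) (a : CharField) :
    cosetSum c (SkewMonoidAlgebra.single v a) =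
      if (QuotientGroup.mk v : weylGroup ⧸ finiteWeylGroup) = c then bar a else 0 :=
  SkewMonoidAlgebra.sum_single_index (by simp)

theorem cosetSum_single_mul (g u : weylGroup) (a : CharField) (f : TwistedGroupRing) :
    cosetSum (QuotientGroup.mk u) (SkewMonoidAlgebra.single g a * f) =
      bar a * (g • cosetSum (QuotientGroup.mk (g⁻¹ * u)) f) := by
  classical
  induction f using SkewMonoidAlgebra.induction_on with
  | zero => simp [cosetSum]
  | add f f' h h' => rw [mul_add, cosetSum_add, h, h', cosetSum_add, smul_add, mul_add]
  | single v q =>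
    rw [SkewMonoidAlgebra.single_mul_single, cosetSum_single, cosetSum_single]
    simp only [QuotientGroup.eq, mul_inv_rev, mul_assoc]
    split_ifs
    · rw [map_mul, bar_smul]
    · simp

theorem cosetSum_Tsimple_mul (i : Fin 2) (u : weylGroup) (f : TwistedGroupRing) :
    cosetSum (QuotientGroup.mk u) (Tsimple i * f) =
      (1 - (e (simpleRoot i))⁻¹)⁻¹ * (s i • cosetSum (QuotientGroup.mk (s i * u)) f) +
        (1 - e (simpleRoot i))⁻¹ * cosetSum (QuotientGroup.mk u) f := by
  have he : e (-simpleRoot i) = (e (simpleRoot i))⁻¹ := by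
    refine eq_inv_of_mul_eq_one_left ?_
    rw [e, e, ← map_mul, AddMonoidAlgebra.single_mul_single]
    simp [AddMonoidAlgebra.one_def]
  rw [Tsimple, add_mul, cosetSum_add, cosetSum_single_mul, cosetSum_single_mul,
    inv_eq_of_mul_eq_one_left (s_mul_self i), ← he]
  simp [bar_e]

theorem Rschubert_zero (m : ℕ) : Rschubert m 0 = if m = 0 then 1 else 0 := by
  classical
  have h : T (word 0) = SkewMonoidAlgebra.single 1 1 := by
    rw [T, word, List.map_nil, List.prod_nil, SkewMonoidAlgebra.one_def]
  rw [Rschubert_eq_cosetSum, h, cosetSum_single, map_one]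
  refine if_congr ?_ rfl rfl
  rw [eq_comm, mk_w_eq_mk_one_iff]

theorem Rschubert_succ {m m' n : ℕ}
    (h : (QuotientGroup.mk (s (letter (n + 1)) * w m) : weylGroup ⧸ finiteWeylGroup) =
      QuotientGroup.mk (w m')) :
    Rschubert m (n + 1) =
      (1 - (e (simpleRoot (letter (n + 1))))⁻¹)⁻¹ * (s (letter (n + 1)) • Rschubert m' n) +
        (1 - e (simpleRoot (letter (n + 1))))⁻¹ * Rschubert m n := by
  have hT : T (word (n + 1)) = Tsimple (letter (n + 1)) * T (word n) := by
    rw [T, word_succ, List.map_cons, List.prod_cons]; rfl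
  rw [Rschubert_eq_cosetSum, hT, cosetSum_Tsimple_mul, h, ← Rschubert_eq_cosetSum,
    ← Rschubert_eq_cosetSum]

/-! ### Products of `q`-Pochhammer type -/

section Field

variable {F : Type*} [Field F]

/-- The product `(q; q)_n`. -/
def qFactorial (q : F) (n : ℕ) : F := ∏ j ∈ Finset.range n, (1 - q ^ (j + 1))

/-- The product `(q; q)_n (z q; q)_n`. -/
def pairProd (q z : F) (n : ℕ) : F :=
  ∏ j ∈ Finset.range n, ((1 - q ^ (j + 1)) * (1 - z * q ^ (j + 1)))

theorem qFactorial_succ (q : F) (n : ℕ) :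
    qFactorial q (n + 1) = qFactorial q n * (1 - q ^ (n + 1)) := Finset.prod_range_succ _ _

theorem pairProd_succ (q z : F) (n : ℕ) :
    pairProd q z (n + 1) = pairProd q z n * ((1 - q ^ (n + 1)) * (1 - z * q ^ (n + 1))) :=
  Finset.prod_range_succ _ _

theorem map_qFactorial {F' : Type*} [Field F'] (φ : F →+* F') (q : F) (n : ℕ) :
    φ (qFactorial q n) = qFactorial (φ q) n := by
  simp [qFactorial]

theorem map_pairProd {F' : Type*} [Field F'] (φ : F →+* F') (q z : F) (n : ℕ) :
    φ (pairProd q z n) = pairProd (φ q) (φ z) n := by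
  simp [pairProd]

/-- The conditions on `q` and `u` under which no denominator in the closed formulas vanishes. -/
structure Generic (q u : F) : Prop where
  pow_ne : ∀ j : ℕ, q ^ (j + 1) ≠ 1
  mul_ne : ∀ j : ℕ, u * q ^ (j + 1) ≠ 1
  inv_mul_ne : ∀ j : ℕ, u⁻¹ * q ^ (j + 1) ≠ 1

theorem Generic.inv {q u : F} (h : Generic q u) : Generic q u⁻¹ :=
  ⟨h.pow_ne, h.inv_mul_ne, by simpa using h.mul_ne⟩

theorem Generic.pairProd_ne_zero {q u : F} (h : Generic q u) (n : ℕ) : pairProd q u n ≠ 0 :=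
  Finset.prod_ne_zero_iff.2 fun j _ =>
    mul_ne_zero (sub_ne_zero.2 (h.pow_ne j).symm) (sub_ne_zero.2 (h.mul_ne j).symm)

theorem Generic.inv_pairProd {q u : F} (h : Generic q u) (n : ℕ) :
    (pairProd q u n)⁻¹ =
      (1 - q ^ (n + 1)) * (1 - u * q ^ (n + 1)) * (pairProd q u (n + 1))⁻¹ := by
  have h1 := h.pairProd_ne_zero (n + 1)
  rw [eq_mul_inv_iff_mul_eq₀ h1, pairProd_succ, inv_mul_cancel_left₀ (h.pairProd_ne_zero n)]

/-- The closed formula for the function of the `n`-th Schubert variety at the `m`-th fixed point,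
where `u` is the image of `e^{α₁}` under `w_m`. -/
def closedForm (q u : F) (m n : ℕ) : F :=
  if m ≤ n then
    qFactorial q n * (pairProd q u ((n - m) / 2))⁻¹ * (pairProd q u⁻¹ (n - (n - m) / 2))⁻¹
  else 0

theorem closedForm_of_lt (q u : F) {m n : ℕ} (h : n < m) : closedForm q u m n = 0 :=
  if_neg (not_le.2 h)

theorem closedForm_eq (q u : F) {m n : ℕ} (d k : ℕ) (h : m ≤ n) (hd : (n - m) / 2 = d)
    (hk : n = d + k) :
    closedForm q u m n = qFactorial q n * (pairProd q u d)⁻¹ * (pairProd q u⁻¹ k)⁻¹ := by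
  rw [closedForm, if_pos h, hd, show n - d = k by omega]

theorem map_closedForm {F' : Type*} [Field F'] (φ : F →+* F') (q u : F) (m n : ℕ) :
    φ (closedForm q u m n) = closedForm (φ q) (φ u) m n := by
  rw [closedForm, closedForm]
  split_ifs
  · simp only [map_mul, map_inv₀, map_qFactorial, map_pairProd]
  · exact map_zero φ

theorem pascal_identity {z : F} (hz : z ≠ 0) (hz1 : z ≠ 1) (a c : F) :
    1 - a * c = (1 - z⁻¹)⁻¹ * ((1 - c) * (1 - z⁻¹ * a)) + (1 - z)⁻¹ * ((1 - a) * (1 - z * c)) := by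
  have h1 : 1 - z ≠ 0 := sub_ne_zero.2 hz1.symm
  have h2 : (1 - z⁻¹)⁻¹ = -z * (1 - z)⁻¹ := by
    rw [inv_eq_iff_eq_inv, mul_inv, inv_inv, inv_neg]
    field_simp
    ring
  rw [h2]
  field_simp
  ring

theorem closedForm_recursion_same_parity {q z u : F} {m n d : ℕ} (h : Generic q u) (hq : q ≠ 0)
    (hz : z ≠ 0) (hz1 : z ≠ 1) (hu : u = z * q ^ m) (hn : n + 1 = m + 2 * d) {A : F}
    (hA : A = qFactorial q n * (pairProd q u d)⁻¹ * (pairProd q u⁻¹ (m + d - 1))⁻¹) :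
    closedForm q u m (n + 1) = (1 - z⁻¹)⁻¹ * A + (1 - z)⁻¹ * closedForm q u m n := by
  obtain ⟨k, hk⟩ : ∃ k, m + d = k + 1 := ⟨m + d - 1, by omega⟩
  have hB : closedForm q u m n = qFactorial q n * (pairProd q u d)⁻¹ *
      (pairProd q u⁻¹ (k + 1))⁻¹ * ((1 - q ^ d) * (1 - z * q ^ (m + d))) := by
    rcases d with _ | d
    · rw [closedForm_of_lt _ _ (by omega)]; simp
    · rw [closedForm_eq q u d (k + 1) (by omega) (by omega) (by omega), h.inv_pairProd d, hu]
      ring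
  have hA' : A = qFactorial q n * (pairProd q u d)⁻¹ * (pairProd q u⁻¹ (k + 1))⁻¹ *
      ((1 - q ^ (m + d)) * (1 - z⁻¹ * q ^ d)) := by
    rw [hA, show m + d - 1 = k by omega, h.inv.inv_pairProd k, hk.symm]
    have : u⁻¹ * q ^ (m + d) = z⁻¹ * q ^ d := by
      rw [hu, pow_add]; field_simp
    rw [this]
    ring
  rw [hB, hA', closedForm_eq q u d (k + 1) (by omega) (by omega) (by omega), qFactorial_succ,
    show n + 1 = d + (m + d) by omega, pow_add q d,
    pascal_identity hz hz1 (q ^ d) (q ^ (m + d))]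
  ring

theorem closedForm_recursion_other_parity {q z u : F} {m n d : ℕ} (h : Generic q u) (hq : q ≠ 0)
    (hz : z ≠ 0) (hz1 : z ≠ 1) (hu : u = z⁻¹ * q ^ (m + 1)) (hn : n = m + 2 * d) :
    closedForm q u m (n + 1) =
      (1 - z⁻¹)⁻¹ * closedForm q u (m + 1) n + (1 - z)⁻¹ * closedForm q u m n := by
  have hA : closedForm q u (m + 1) n = qFactorial q n * (pairProd q u d)⁻¹ *
      (pairProd q u⁻¹ (m + d + 1))⁻¹ * ((1 - q ^ d) * (1 - z⁻¹ * q ^ (m + d + 1))) := by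
    rcases d with _ | d
    · rw [closedForm_of_lt _ _ (by omega)]; simp
    · rw [closedForm_eq q u d (m + (d + 1) + 1) (by omega) (by omega) (by omega),
        h.inv_pairProd d, hu]
      ring
  have hB : closedForm q u m n = qFactorial q n * (pairProd q u d)⁻¹ *
      (pairProd q u⁻¹ (m + d + 1))⁻¹ * ((1 - q ^ (m + d + 1)) * (1 - z * q ^ d)) := by
    rw [closedForm_eq q u d (m + d) (by omega) (by omega) (by omega), h.inv.inv_pairProd (m + d)]
    have : u⁻¹ * q ^ (m + d + 1) = z * q ^ d := by
      rw [hu, show m + d + 1 = (m + 1) + d by omega, pow_add]; field_simp; ring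
    rw [this]
    ring
  rw [hB, hA, closedForm_eq q u d (m + d + 1) (by omega) (by omega) (by omega), qFactorial_succ,
    show n + 1 = (m + d + 1) + d by omega, pow_add q (m + d + 1),
    pascal_identity hz hz1 (q ^ (m + d + 1)) (q ^ d)]
  ring

end Field

/-! ### Exponentials -/

theorem e_zero : e 0 = 1 := by
  rw [e, ← AddMonoidAlgebra.one_def, map_one]

theorem e_add (β γ : RootLattice) : e (β + γ) = e β * e γ := by
  rw [e, e, e, ← map_mul, AddMonoidAlgebra.single_mul_single, mul_one]

theorem e_neg (β : RootLattice) : e (-β) = (e β)⁻¹ :=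
  eq_inv_of_mul_eq_one_left (by rw [← e_add, neg_add_cancel, e_zero])

theorem e_nsmul (n : ℕ) (β : RootLattice) : e (n • β) = e β ^ n := by
  induction n with
  | zero => rw [zero_nsmul, e_zero, pow_zero]
  | succ n ih => rw [succ_nsmul, e_add, ih, pow_succ]

theorem e_sum {ι : Type*} (t : Finset ι) (f : ι → RootLattice) :
    e (∑ k ∈ t, f k) = ∏ k ∈ t, e (f k) := by
  classical
  induction t using Finset.induction_on with
  | empty => simp [e_zero]
  | insert a t ha ih => rw [Finset.sum_insert ha, Finset.prod_insert ha, e_add, ih]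

theorem e_injective : Function.Injective e := fun β γ h => by
  have h' := IsFractionRing.injective CharRing CharField h
  have h'' := congrArg AddMonoidAlgebra.coeff h'
  rw [AddMonoidAlgebra.coeff_single, AddMonoidAlgebra.coeff_single] at h''
  exact Finsupp.single_left_injective one_ne_zero h''

theorem e_ne_zero (β : RootLattice) : e β ≠ 0 := fun h => by
  have h1 := e_add β (-β)
  rw [h, zero_mul, add_neg_cancel, e_zero] at h1
  exact one_ne_zero h1

theorem e_ne_one {i : Fin 2} {a k : ℤ} (h : a ≠ 0 ∨ k ≠ 0) :
    e (a • simpleRoot i + k • delta) ≠ 1 := by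
  rw [← e_zero, e_injective.ne_iff,
    show (0 : RootLattice) = (0 : ℤ) • simpleRoot i + (0 : ℤ) • delta by module]
  intro h'
  obtain ⟨rfl, rfl⟩ := smul_simpleRoot_add_smul_delta_inj i h'
  simp at h

/-! ### The closed formula for the functions of the Schubert varieties -/

/-- The exponential `e^{w_m α₁}`. -/
def chainExp (m : ℕ) : CharField := e ((w m).1 (simpleRoot 1))

theorem chainExp_eq (m : ℕ) : chainExp m = e (simpleRoot (letter m)) * e delta ^ m := by
  rw [chainExp, w_simpleRoot_one, e_add, e_nsmul]

theorem generic_chainExp (m : ℕ) : Generic (e delta) (chainExp m) := by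
  rw [chainExp_eq, ← e_nsmul, ← e_add]
  refine ⟨fun j => ?_, fun j => ?_, fun j => ?_⟩
  · rw [← e_nsmul, show (j + 1) • delta = (0 : ℤ) • simpleRoot 0 + ((j : ℤ) + 1) • delta by module]
    exact e_ne_one (by omega)
  · rw [← e_nsmul, ← e_add, show simpleRoot (letter m) + m • delta + (j + 1) • delta =
      (1 : ℤ) • simpleRoot (letter m) + ((m : ℤ) + j + 1) • delta by module]
    exact e_ne_one (by omega)
  · rw [← e_nsmul, ← e_neg, ← e_add, show -(simpleRoot (letter m) + m • delta) + (j + 1) • delta =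
      (-1 : ℤ) • simpleRoot (letter m) + (-(m : ℤ) + j + 1) • delta by module]
    exact e_ne_one (by omega)

theorem s_smul_e (i : Fin 2) (β : RootLattice) : s i • e β = e (reflection i β) := smul_e _ _

theorem s_smul_chainExp (m : ℕ) : s (letter (m + 1)) • chainExp m = chainExp (m + 1) := by
  rw [chainExp, chainExp, smul_e, w_succ]; rfl

theorem s_smul_chainExp_succ (m : ℕ) : s (letter (m + 1)) • chainExp (m + 1) = chainExp m := by
  rw [← s_smul_chainExp, ← mul_smul, s_mul_self, one_smul]

theorem s_smul_chainExp_zero : s 1 • chainExp 0 = (chainExp 0)⁻¹ := by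
  rw [chainExp, w_simpleRoot_one, zero_smul, add_zero, s_smul_e, ← e_neg]
  exact congrArg e (reflection_simpleRoot_self 1)

theorem s_smul_closedForm (i : Fin 2) (u : CharField) (m n : ℕ) :
    s i • closedForm (e delta) u m n = closedForm (e delta) (s i • u) m n := by
  have h := map_closedForm (MulSemiringAction.toRingHom weylGroup CharField (s i)) (e delta) u m n
  simp only [MulSemiringAction.toRingHom_apply, s_smul_e, reflection_delta] at h
  exact h

theorem Rschubert_eq_closedForm (m n : ℕ) :
    Rschubert m n = closedForm (e delta) (chainExp m) m n := by
  induction n generalizing m with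
  | zero =>
    rw [Rschubert_zero, closedForm]
    rcases Nat.eq_zero_or_pos m with rfl | hm
    · simp [qFactorial, pairProd]
    · rw [if_neg hm.ne', if_neg (by omega)]
  | succ n ih =>
    have hq : e delta ≠ 0 := e_ne_zero _
    have hz : ∀ i, e (simpleRoot i) ≠ 0 := fun i => e_ne_zero _
    have hz1 : ∀ i, e (simpleRoot i) ≠ 1 := fun i => by
      have := e_ne_one (i := i) (a := 1) (k := 0) (Or.inl one_ne_zero)
      simpa using this
    by_cases hp : (n + 1) % 2 = m % 2
    · have hl : letter (n + 1) = letter m := letter_congr hp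
      rw [Rschubert_succ (m' := m - 1) (by rw [hl]; exact mk_s_mul_w m), ih, ih,
        s_smul_closedForm, hl]
      rcases lt_or_ge (n + 1) m with hlt | hle
      · rw [closedForm_of_lt _ _ (by omega), closedForm_of_lt _ _ (by omega),
          closedForm_of_lt _ _ hlt]
        simp
      obtain ⟨d, hd⟩ : ∃ d, n + 1 = m + 2 * d := ⟨(n + 1 - m) / 2, by omega⟩
      refine (closedForm_recursion_same_parity (d := d) (generic_chainExp m) hq (hz _) (hz1 _)
        (chainExp_eq m) hd ?_).symm
      rcases m with _ | m
      · obtain ⟨d, rfl⟩ : ∃ d', d = d' + 1 := ⟨d - 1, by omega⟩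
        rw [closedForm_eq _ _ d (d + 1) (by omega) (by omega) (by omega),
          show letter 0 = 1 from rfl, s_smul_chainExp_zero, inv_inv, mul_right_comm,
          show 0 + (d + 1) - 1 = d by omega]
      · rw [Nat.add_sub_cancel, s_smul_chainExp,
          closedForm_eq _ _ d (m + 1 + d - 1) (by omega) (by omega) (by omega)]
    · have hl : letter (n + 1) = letter (m + 1) := letter_congr (by omega)
      rw [Rschubert_succ (m' := m + 1) (by rw [hl, w_succ]), ih, ih,
        s_smul_closedForm, hl, s_smul_chainExp_succ]
      rcases lt_or_ge n m with hlt | hle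
      · rw [closedForm_of_lt _ _ (by omega), closedForm_of_lt _ _ (by omega),
          closedForm_of_lt _ _ (by omega)]
        simp
      refine (closedForm_recursion_other_parity (d := (n - m) / 2) (generic_chainExp m) hq (hz _)
        (hz1 _) ?_ (by omega)).symm
      rw [← s_smul_chainExp_succ, chainExp_eq, ← e_nsmul, ← e_add, s_smul_e, map_add, map_nsmul,
        reflection_delta, reflection_simpleRoot_self, e_add, e_neg, e_nsmul]

/-! ### Cancellation of the denominators -/

/-- The product of `1 - e^{a + k δ}` over `k < n`. -/
def stringProd (a : RootLattice) (n : ℕ) : CharField :=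
  ∏ k ∈ Finset.range n, (1 - e (a + k • delta))

/-- The product of `1 - e^{a + k δ}` over `k < n`, as a formal power series. -/
def formalStringProd (a : RootLattice) (n : ℕ) : FormalSeries :=
  ∏ k ∈ Finset.range n, (1 - formalExp (a + k • delta))

/-- The numerator of the limit function at the `m`-th fixed point. -/
def numerator (m : ℕ) : CharField :=
  (-1) ^ m * e (inversionSum (word m)) * (1 - e ((w m).1 (simpleRoot 1)))

theorem e_add_nsmul_delta (a : RootLattice) (k : ℕ) : e (a + k • delta) = e a * e delta ^ k := by
  rw [e_add, e_nsmul]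

theorem qFactorial_eq_stringProd (n : ℕ) : qFactorial (e delta) n = stringProd delta n :=
  Finset.prod_congr rfl fun k _ => by rw [e_add_nsmul_delta, pow_succ']

theorem pairProd_eq (u : CharField) (n : ℕ) : pairProd (e delta) u n =
    stringProd delta n * ∏ k ∈ Finset.range n, (1 - u * e delta ^ (k + 1)) := by
  rw [pairProd, Finset.prod_mul_distrib, ← qFactorial_eq_stringProd, qFactorial]

theorem stringProd_letter (m d : ℕ) : stringProd (simpleRoot (letter m)) (m + 1 + d) =
    stringProd (simpleRoot (letter m)) m * (1 - chainExp m) *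
      ∏ k ∈ Finset.range d, (1 - chainExp m * e delta ^ (k + 1)) := by
  rw [stringProd, Finset.prod_range_add, Finset.prod_range_succ, ← stringProd, chainExp_eq,
    e_add_nsmul_delta]
  congr 1
  refine Finset.prod_congr rfl fun k _ => ?_
  rw [e_add_nsmul_delta]
  ring

theorem e_simpleRoot_letter_succ (m : ℕ) :
    e (simpleRoot (letter (m + 1))) = (e (simpleRoot (letter m)))⁻¹ * e delta := by
  rw [← simpleRoot_add_of_ne (letter_succ_ne m), e_add,
    mul_comm (e (simpleRoot (letter (m + 1)))), inv_mul_cancel_left₀ (e_ne_zero _)]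

theorem stringProd_letter_eq_neg (m : ℕ) : stringProd (simpleRoot (letter m)) m =
    (∏ k ∈ Finset.range m, (1 - (chainExp m)⁻¹ * e delta ^ (k + 1))) *
      ((-1) ^ m * e (inversionSum (word m))) := by
  have hc : ((-1 : CharField)) ^ m = ∏ _k ∈ Finset.range m, (-1) := by
    rw [Finset.prod_const, Finset.card_range]
  rw [← Finset.prod_range_reflect, inversionSum_word, e_sum, hc, ← Finset.prod_mul_distrib,
    ← Finset.prod_mul_distrib, stringProd]
  refine Finset.prod_congr rfl fun k hk => ?_
  obtain ⟨l, hl⟩ : ∃ l, m = k + 1 + l := ⟨m - (k + 1), by have := Finset.mem_range.1 hk; omega⟩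
  have hx := e_ne_zero (simpleRoot (letter m))
  have hq := e_ne_zero delta
  rw [chainExp_eq, e_add_nsmul_delta, show m - 1 - k + 1 = l + 1 by omega]
  have hpow : e delta ^ m = e delta ^ (l + 1) * e delta ^ k := by
    rw [← pow_add]; congr 1; omega
  have : (e (simpleRoot (letter m)) * e delta ^ m)⁻¹ * e delta ^ (l + 1) =
      (e (simpleRoot (letter m)) * e delta ^ k)⁻¹ := by
    refine eq_inv_of_mul_eq_one_left ?_
    rw [mul_assoc,
      show e delta ^ (l + 1) * (e (simpleRoot (letter m)) * e delta ^ k) =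
        e (simpleRoot (letter m)) * e delta ^ m by
          rw [hpow]; ring,
      inv_mul_cancel₀ (mul_ne_zero hx (pow_ne_zero _ hq))]
  rw [this, sub_mul, one_mul, neg_one_mul, mul_neg,
    inv_mul_cancel₀ (mul_ne_zero hx (pow_ne_zero _ hq))]
  ring

theorem prod_inv_chainExp (m k : ℕ) :
    ∏ l ∈ Finset.range (m + k), (1 - (chainExp m)⁻¹ * e delta ^ (l + 1)) =
      (∏ l ∈ Finset.range m, (1 - (chainExp m)⁻¹ * e delta ^ (l + 1))) *
        stringProd (simpleRoot (letter (m + 1))) k := by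
  rw [Finset.prod_range_add, stringProd]
  congr 1
  refine Finset.prod_congr rfl fun l _ => ?_
  have hx := e_ne_zero (simpleRoot (letter m))
  have hq := e_ne_zero delta
  rw [e_add_nsmul_delta, e_simpleRoot_letter_succ, chainExp_eq, pow_succ, pow_add]
  field_simp

theorem Rschubert_mul_stringProds (m d k : ℕ)
    (hd : (d + (m + k) - m) / 2 = d) :
    Rschubert m (d + (m + k)) *
        (stringProd (simpleRoot (letter m)) (m + 1 + d) *
          stringProd (simpleRoot (letter (m + 1))) k *
            (stringProd delta d * stringProd delta (m + k))) =
      numerator m * stringProd delta (d + (m + k)) := by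
  have h1 := (generic_chainExp m).pairProd_ne_zero d
  have h2 := (generic_chainExp m).inv.pairProd_ne_zero (m + k)
  rw [Rschubert_eq_closedForm, closedForm_eq _ _ d (m + k) (by omega) hd rfl,
    qFactorial_eq_stringProd, mul_assoc, mul_assoc,
    show stringProd (simpleRoot (letter m)) (m + 1 + d) *
          stringProd (simpleRoot (letter (m + 1))) k *
            (stringProd delta d * stringProd delta (m + k)) =
      pairProd (e delta) (chainExp m) d * (pairProd (e delta) (chainExp m)⁻¹ (m + k) *
        numerator m) by
      rw [pairProd_eq, pairProd_eq, prod_inv_chainExp, stringProd_letter, stringProd_letter_eq_neg,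
        numerator, chainExp]
      ring,
    mul_left_comm (pairProd _ _ (m + k))⁻¹, inv_mul_cancel_left₀ h2, inv_mul_cancel_left₀ h1,
    mul_comm]

/-! ### Passage to formal power series -/

theorem simpleRoot_nonneg (i : Fin 2) : 0 ≤ simpleRoot i := by
  rw [simpleRoot, Pi.single_nonneg]; exact zero_le_one

theorem delta_nonneg : 0 ≤ delta := add_nonneg (simpleRoot_nonneg 0) (simpleRoot_nonneg 1)

theorem add_nsmul_delta_nonneg {a : RootLattice} (ha : 0 ≤ a) (k : ℕ) : 0 ≤ a + k • delta :=
  add_nonneg ha (nsmul_nonneg delta_nonneg k)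

theorem expand_stringProd {a : RootLattice} (ha : 0 ≤ a) (n : ℕ) :
    expand (stringProd a n) = algebraMap FormalSeries FormalField (formalStringProd a n) := by
  rw [stringProd, formalStringProd, map_prod, map_prod]
  refine Finset.prod_congr rfl fun k _ => ?_
  rw [map_sub, map_sub, map_one, map_one, expand_e_of_nonneg (add_nsmul_delta_nonneg ha k)]

/-- The formal power series that expands `numerator m`. -/
def formalNumerator (m : ℕ) : FormalSeries :=
  (-1) ^ m * formalExp (inversionSum (word m)) * (1 - formalExp ((w m).1 (simpleRoot 1)))

theorem expand_numerator (m : ℕ) :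
    expand (numerator m) = algebraMap FormalSeries FormalField (formalNumerator m) := by
  have h1 : 0 ≤ inversionSum (word m) := by
    rw [inversionSum_word]
    exact Finset.sum_nonneg fun k _ => add_nsmul_delta_nonneg (simpleRoot_nonneg _) k
  have h2 : 0 ≤ (w m).1 (simpleRoot 1) := by
    rw [w_simpleRoot_one]
    exact add_nsmul_delta_nonneg (simpleRoot_nonneg _) m
  simp only [numerator, formalNumerator, map_mul, map_pow, map_neg, map_one, map_sub,
    expand_e_of_nonneg h1, expand_e_of_nonneg h2]

theorem constantCoeff_formalExp {β : RootLattice} (h : 0 ≤ β) (h0 : β ≠ 0) :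
    MvPowerSeries.constantCoeff (formalExp β) = 0 := by
  obtain ⟨i, hi⟩ := Function.ne_iff.1 h0
  rw [formalExp, map_prod]
  refine Finset.prod_eq_zero (Finset.mem_univ i) ?_
  have h1 : 0 ≤ β i := h i
  have h2 : β i ≠ 0 := hi
  rw [map_pow, MvPowerSeries.constantCoeff_X, zero_pow (by omega)]

theorem add_nsmul_delta_ne_zero {a : RootLattice} (h : 0 ≤ a) (h0 : a ≠ 0) (k : ℕ) :
    a + k • delta ≠ 0 := fun h' =>
  h0 (le_antisymm ((le_add_of_nonneg_right (nsmul_nonneg delta_nonneg k)).trans h'.le) h)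

theorem constantCoeff_formalStringProd {a : RootLattice} (h : 0 ≤ a) (h0 : a ≠ 0) (n : ℕ) :
    MvPowerSeries.constantCoeff (formalStringProd a n) = 1 := by
  rw [formalStringProd, map_prod]
  refine Finset.prod_eq_one fun k _ => ?_
  rw [map_sub, map_one, constantCoeff_formalExp (add_nsmul_delta_nonneg h k)
    (add_nsmul_delta_ne_zero h h0 k), sub_zero]

theorem le_order_formalExp (a : RootLattice) (h : 0 ≤ a) (k : ℕ) :
    (k : ℕ∞) ≤ (formalExp (a + k • delta)).order := by
  rw [formalExp_eq_monomial, MvPowerSeries.order_monomial_of_ne_zero one_ne_zero, Nat.cast_le]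
  have h0 : 0 ≤ a 0 := h 0
  rw [Finsupp.degree_eq_sum, Fin.sum_univ_two]
  simp [delta, simpleRoot]
  omega

theorem exists_hasProd_string {a : RootLattice} (h : 0 ≤ a) (h0 : a ≠ 0) :
    ∃ D : FormalSeries, HasProd (fun k : ℕ => 1 - formalExp (a + k • delta)) D ∧
      MvPowerSeries.constantCoeff D = 1 := by
  have hm : Multipliable fun k : ℕ => 1 + -formalExp (a + k • delta) := by
    refine MvPowerSeries.WithPiTopology.multipliable_one_add_of_tendsto_order_atTop_nhds_top ?_
    simp only [MvPowerSeries.order_neg]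
    exact tendsto_of_tendsto_of_tendsto_of_le_of_le ENat.tendsto_natCast_nhds_top tendsto_const_nhds
      (fun k => le_order_formalExp a h k) fun _ => le_top
  simp only [← sub_eq_add_neg] at hm
  obtain ⟨D, hD⟩ := hm
  refine ⟨D, hD, ?_⟩
  have h1 := hD.map (MvPowerSeries.constantCoeff (σ := Fin 2) (R := ℤ))
    (MvPowerSeries.WithPiTopology.continuous_constantCoeff ℤ)
  refine h1.unique ?_
  convert hasProd_one with k
  rw [Function.comp_apply, map_sub, map_one, constantCoeff_formalExp (add_nsmul_delta_nonneg h k)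
    (add_nsmul_delta_ne_zero h h0 k), sub_zero]

/-! ### The positive roots -/

theorem positiveRoots_eq {i j : Fin 2} (hij : i ≠ j) : positiveRoots =
    Set.range (fun k : ℕ => simpleRoot i + k • delta) ∪
      Set.range (fun k : ℕ => simpleRoot j + k • delta) ∪
        Set.range (fun k : ℕ => delta + k • delta) := by
  have main : positiveRoots = Set.range (fun k : ℕ => simpleRoot 0 + k • delta) ∪
      Set.range (fun k : ℕ => simpleRoot 1 + k • delta) ∪
        Set.range (fun k : ℕ => delta + k • delta) := by
    have e0 : simpleRoot 0 = -simpleRoot 1 + delta := by rw [delta]; abel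
    ext β
    constructor
    · rintro ⟨⟨n, rfl | rfl⟩ | ⟨n, hn, rfl⟩, h⟩
      · have h0 : 0 ≤ (simpleRoot 1 + n • delta) 0 := h 0
        simp [simpleRoot, delta] at h0
        exact Or.inl (Or.inr ⟨n.toNat, by
          simp only [← natCast_zsmul, Int.toNat_of_nonneg h0]⟩)
      · have h0 : 0 ≤ (-simpleRoot 1 + n • delta) 1 := h 1
        simp [simpleRoot, delta] at h0
        refine Or.inl (Or.inl ⟨(n - 1).toNat, ?_⟩)
        simp only [← natCast_zsmul, Int.toNat_of_nonneg (sub_nonneg.2 h0), e0]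
        module
      · have h0 : 0 ≤ (n • delta) 0 := h 0
        simp [simpleRoot, delta] at h0
        refine Or.inr ⟨(n - 1).toNat, ?_⟩
        simp only [← natCast_zsmul, Int.toNat_of_nonneg (show 0 ≤ n - 1 by omega)]
        module
    · rintro ((⟨k, rfl⟩ | ⟨k, rfl⟩) | ⟨k, rfl⟩)
      · refine ⟨Or.inl ⟨k + 1, Or.inr ?_⟩, add_nsmul_delta_nonneg (simpleRoot_nonneg _) k⟩
        simp only [e0]
        module
      · refine ⟨Or.inl ⟨k, Or.inl ?_⟩, add_nsmul_delta_nonneg (simpleRoot_nonneg _) k⟩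
        simp
      · refine ⟨Or.inr ⟨k + 1, by omega, ?_⟩, add_nsmul_delta_nonneg delta_nonneg k⟩
        module
  rw [main]
  fin_cases i <;> fin_cases j <;> simp_all [Set.union_comm]

theorem add_nsmul_delta_injective (a : RootLattice) :
    Function.Injective fun k : ℕ => a + k • delta := fun k l h => by
  have := congrFun (add_left_cancel h) 0
  simpa [delta, simpleRoot] using this

theorem hasProd_positiveRoots {i j : Fin 2} (hij : i ≠ j) {f : RootLattice → FormalSeries}
    {A B C : FormalSeries} (hA : HasProd (fun k : ℕ => f (simpleRoot i + k • delta)) A)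
    (hB : HasProd (fun k : ℕ => f (simpleRoot j + k • delta)) B)
    (hC : HasProd (fun k : ℕ => f (delta + k • delta)) C) :
    HasProd (fun α : positiveRoots => f α.1) (A * B * C) := by
  rw [positiveRoots_eq hij]
  have hj : simpleRoot j = (-1 : ℤ) • simpleRoot i + (1 : ℤ) • delta := by
    rw [← simpleRoot_add_of_ne hij]; module
  refine HasProd.mul_disjoint (f := f) ?_ (HasProd.mul_disjoint (f := f) ?_ ?_ ?_) ?_
  · rw [Set.disjoint_left]
    rintro _ (⟨k, rfl⟩ | ⟨k, rfl⟩) ⟨l, h⟩ <;> dsimp only at h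
    · have h' : (0 : ℤ) • simpleRoot i + ((l : ℤ) + 1) • delta =
          (1 : ℤ) • simpleRoot i + (k : ℤ) • delta := by
        rw [show (1 : ℤ) • simpleRoot i + (k : ℤ) • delta = simpleRoot i + k • delta by module,
          ← h]
        module
      exact absurd (smul_simpleRoot_add_smul_delta_inj i h').1 (by norm_num)
    · have h' : (0 : ℤ) • simpleRoot i + ((l : ℤ) + 1) • delta =
          (-1 : ℤ) • simpleRoot i + ((k : ℤ) + 1) • delta := by
        rw [show (-1 : ℤ) • simpleRoot i + ((k : ℤ) + 1) • delta = simpleRoot j + k • delta by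
          rw [hj]; module, ← h]
        module
      exact absurd (smul_simpleRoot_add_smul_delta_inj i h').1 (by norm_num)
  · rw [Set.disjoint_left]
    rintro _ ⟨k, rfl⟩ ⟨l, h⟩
    dsimp only at h
    have h' : (-1 : ℤ) • simpleRoot i + ((l : ℤ) + 1) • delta =
        (1 : ℤ) • simpleRoot i + (k : ℤ) • delta := by
      rw [show (1 : ℤ) • simpleRoot i + (k : ℤ) • delta = simpleRoot i + k • delta by module,
        ← h]
      simp only [hj]
      module
    exact absurd (smul_simpleRoot_add_smul_delta_inj i h').1 (by norm_num)
  · exact (add_nsmul_delta_injective _).hasProd_range_iff.2 hA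
  · exact (add_nsmul_delta_injective _).hasProd_range_iff.2 hB
  · exact (add_nsmul_delta_injective _).hasProd_range_iff.2 hC

/-! ### The limit -/

theorem tendsto_of_mul_eq_one {R ι : Type*} [CommRing R] [TopologicalSpace R] [IsTopologicalRing R]
    [IsLinearTopology R R] {l : Filter ι} {f g : ι → R} {a b : R} (hf : Tendsto f l (𝓝 a))
    (hfg : ∀ n, f n * g n = 1) (hab : a * b = 1) : Tendsto g l (𝓝 b) := by
  have h0 : Tendsto (fun n => a - f n) l (𝓝 0) := by
    simpa using (tendsto_const_nhds (x := a)).sub hf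
  have h1 := IsLinearTopology.tendsto_mul_zero_of_right (fun n => g n * b) _ h0
  have h2 : ((fun n => g n * b) * fun n => a - f n) = fun n => g n - b := funext fun n => by
    change g n * b * (a - f n) = g n - b
    linear_combination g n * hab - b * hfg n
  rw [h2] at h1
  simpa using h1.add_const b

theorem isLoopGroupR {m : ℕ} {A B C I : FormalSeries}
    (hA : HasProd (fun k : ℕ => 1 - formalExp (simpleRoot (letter m) + k • delta)) A)
    (hB : HasProd (fun k : ℕ => 1 - formalExp (simpleRoot (letter (m + 1)) + k • delta)) B)
    (hC : HasProd (fun k : ℕ => 1 - formalExp (delta + k • delta)) C)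
    (hI : A * B * (C * C) * I = 1) : IsLoopGroupR m (formalNumerator m * C * I) := by
  have hr : ∀ i, simpleRoot i ≠ 0 := fun i h => by
    simpa [simpleRoot] using congrFun h i
  have hδ : delta ≠ 0 := fun h => by simpa [simpleRoot, delta] using congrFun h 0
  let d : ℕ → ℕ := fun n => (n - m) / 2
  let den : ℕ → FormalSeries := fun n =>
    formalStringProd (simpleRoot (letter m)) (m + 1 + d n) *
      formalStringProd (simpleRoot (letter (m + 1))) (n - m - d n) *
        (formalStringProd delta (d n) * formalStringProd delta (n - d n))
  have hden : ∀ n, den n * MvPowerSeries.invOfUnit (den n) 1 = 1 := fun n => by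
    refine MvPowerSeries.mul_invOfUnit _ _ ?_
    simp only [den, map_mul, constantCoeff_formalStringProd (simpleRoot_nonneg _) (hr _),
      constantCoeff_formalStringProd delta_nonneg hδ, mul_one, Units.val_one]
  have hd : Tendsto d atTop atTop :=
    tendsto_atTop_atTop.2 fun b => ⟨m + 2 * b, fun n hn => by simp only [d]; omega⟩
  have hlim : Tendsto den atTop (𝓝 (A * B * (C * C))) := by
    refine ((hA.tendsto_prod_nat.comp ?_).mul (hB.tendsto_prod_nat.comp ?_)).mul
      ((hC.tendsto_prod_nat.comp hd).mul (hC.tendsto_prod_nat.comp ?_))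
    · exact tendsto_atTop_mono (fun n => by simp) hd
    · exact tendsto_atTop_mono (fun n => by simp only [d]; omega) hd
    · exact tendsto_atTop_mono (fun n => by simp only [d]; omega) hd
  refine ⟨fun n => if m ≤ n then formalNumerator m * formalStringProd delta n *
      MvPowerSeries.invOfUnit (den n) 1 else 0, fun n => ?_, ?_⟩
  · beta_reduce
    by_cases hn : m ≤ n
    · rw [if_pos hn]
      have key := Rschubert_mul_stringProds m (d n) (n - m - d n) (by simp only [d]; omega)
      rw [show d n + (m + (n - m - d n)) = n by simp only [d]; omega,
        show m + (n - m - d n) = n - d n by simp only [d]; omega] at key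
      have key' := congrArg expand key
      simp only [map_mul, expand_numerator, expand_stringProd (simpleRoot_nonneg _),
        expand_stringProd delta_nonneg] at key'
      simp only [← map_mul] at key'
      rw [map_mul, map_mul, ← map_mul, ← key', mul_assoc, ← map_mul]
      change _ * algebraMap _ _ (den n * _) = _
      rw [hden, map_one, mul_one]
    · rw [if_neg hn, Rschubert_eq_closedForm, closedForm_of_lt _ _ (not_le.1 hn), map_zero,
        map_zero]
  · have h := (tendsto_const_nhds (x := formalNumerator m)).mul hC.tendsto_prod_nat |>.mul
      (tendsto_of_mul_eq_one hlim hden hI)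
    refine h.congr' ?_
    filter_upwards [eventually_ge_atTop m] with n hn
    rw [if_pos hn]
    rfl

end AffineSL2
end

theorem theorem7p2 (m : ℕ) :
    ∃ R D : AffineSL2.FormalSeries,
      AffineSL2.IsLoopGroupR m R ∧
      HasProd (fun α : AffineSL2.positiveRoots => 1 - AffineSL2.formalExp α.1) D ∧
      D ≠ 0 ∧
      algebraMap AffineSL2.FormalSeries AffineSL2.FormalField R =
        AffineSL2.expand ((-1) ^ m * AffineSL2.e (AffineSL2.inversionSum (AffineSL2.word m)) *
            (1 - AffineSL2.e ((AffineSL2.w m).1 (AffineSL2.simpleRoot 1)))) /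
          algebraMap AffineSL2.FormalSeries AffineSL2.FormalField D := by
  open AffineSL2 in
  have hr : ∀ i, simpleRoot i ≠ 0 := fun i h => by
    simpa [simpleRoot] using congrFun h i
  have hδ : delta ≠ 0 := fun h => by simpa [simpleRoot, delta] using congrFun h 0
  obtain ⟨A, hA, hA1⟩ := exists_hasProd_string (simpleRoot_nonneg (letter m)) (hr _)
  obtain ⟨B, hB, hB1⟩ := exists_hasProd_string (simpleRoot_nonneg (letter (m + 1))) (hr _)
  obtain ⟨C, hC, hC1⟩ := exists_hasProd_string delta_nonneg hδ
  have hI := MvPowerSeries.mul_invOfUnit (A * B * (C * C)) 1 (by simp [hA1, hB1, hC1])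
  have hD : A * B * C ≠ 0 := fun h => by
    have := congrArg MvPowerSeries.constantCoeff h
    simp [hA1, hB1, hC1] at this
  refine ⟨_, A * B * C, isLoopGroupR hA hB hC hI,
    hasProd_positiveRoots (f := fun β => 1 - formalExp β) (letter_succ_ne m).symm hA hB hC, hD, ?_⟩
  rw [← numerator, expand_numerator, eq_div_iff
    ((FaithfulSMul.algebraMap_eq_zero_iff FormalSeries FormalField).not.2 hD), ← map_mul]
  congr 1
  linear_combination formalNumerator m * hI
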